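/- Let $m$ be a nonzero integer and let $C : U^3 + V^3 = m$, regarded as a plane projective cubic. The rational points $C(\mathbb{Q})$ form a group under the chord and tangent method, with identity the point at infinity $(1:-1:0)$ and with inversion given by reflection in the line $U = V$. Let $R \in C(\mathbb{Q})$ be a nontorsion point and, for each positive integer $n$, write, in lowest terms, $$nR = \left(\frac{U_n}{W_n}, \frac{V_n}{W_n}\right), \qquad W_n > 0.$$ Then $(W_n)$ is a strong divisibility sequence: for all positive integers $r, n$, $$\gcd(W_r, W_n) = W_{\gcd(r,n)}.$$ In particular, $W_n \mid W_{nk}$ for all positive integers $n, k$. -/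

import Mathlib

namespace TwistedFermat

/-- The rational points of the projective cubic `U ^ 3 + V ^ 3 = m * W ^ 3`: the point at infinity
`(1 : -1 : 0)`, which is the only rational one as `-1` has only one rational cube root, and the
affine rational points `(u, v)` with `u ^ 3 + v ^ 3 = m`. -/
inductive Point (m : ℤ) : Type
  | infinity : Point m
  | affine (u v : ℚ) (h : u ^ 3 + v ^ 3 = (m : ℚ)) : Point m

/-- Distinct affine points on a line that is not parallel to `U + V = 0`. -/
theorem chord_ne {m : ℤ} {u₁ v₁ u₂ v₂ : ℚ} (h₁ : u₁ ^ 3 + v₁ ^ 3 = (m : ℚ))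
    (h₂ : u₂ ^ 3 + v₂ ^ 3 = (m : ℚ)) (hs : u₁ + v₁ ≠ u₂ + v₂) :
    (u₁ * u₂ ^ 2 + v₁ * v₂ ^ 2) - (u₁ ^ 2 * u₂ + v₁ ^ 2 * v₂) ≠ 0 := by
  intro h
  have h3 : (u₂ - u₁) ^ 3 = (v₁ - v₂) ^ 3 := by linear_combination h₂ - h₁ - 3 * h
  have h4 : u₂ - u₁ = v₁ - v₂ := (Odd.strictMono_pow (by decide : Odd 3)).injective h3
  exact hs (by linear_combination -h4)

/-- The third point of intersection with the line through two affine points is on the cubic. -/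
theorem chord_mem {m : ℤ} {u₁ v₁ u₂ v₂ t : ℚ} (h₁ : u₁ ^ 3 + v₁ ^ 3 = (m : ℚ))
    (h₂ : u₂ ^ 3 + v₂ ^ 3 = (m : ℚ)) (hs : u₁ + v₁ ≠ u₂ + v₂)
    (ht : t = ((m : ℚ) - (u₁ ^ 2 * u₂ + v₁ ^ 2 * v₂)) /
      ((u₁ * u₂ ^ 2 + v₁ * v₂ ^ 2) - (u₁ ^ 2 * u₂ + v₁ ^ 2 * v₂))) :
    (u₁ + t * (u₂ - u₁)) ^ 3 + (v₁ + t * (v₂ - v₁)) ^ 3 = (m : ℚ) := by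
  have ht' := (eq_div_iff (chord_ne h₁ h₂ hs)).1 ht
  linear_combination (1 - t) ^ 3 * h₁ + t ^ 3 * h₂ + 3 * t * (1 - t) * ht'

/-- The residual point of intersection with the tangent at an affine point is on the cubic. -/
theorem tangent_mem {m : ℤ} {u v t : ℚ} (h : u ^ 3 + v ^ 3 = (m : ℚ)) (huv : u ≠ v)
    (ht : t = 3 * u * v / (u ^ 3 - v ^ 3)) :
    (u + t * v ^ 2) ^ 3 + (v - t * u ^ 2) ^ 3 = (m : ℚ) := by
  have hne : u ^ 3 - v ^ 3 ≠ 0 := fun h0 =>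
    huv ((Odd.strictMono_pow (by decide : Odd 3)).injective (sub_eq_zero.1 h0))
  have ht' := (eq_div_iff hne).1 ht
  linear_combination h - t ^ 2 * (u ^ 3 + v ^ 3) * ht'

namespace Point

variable {m : ℤ}

/-- Reflection in the line `U = V`. -/
def neg : Point m → Point m
  | infinity => infinity
  | affine u v h => affine v u (by rw [add_comm]; exact h)

/-- The chord and tangent construction: `third P Q` is the third point in which the cubic meets the
line through `P` and `Q` (the tangent at `P`, if `P = Q`), counted with multiplicity.

* The tangent at infinity is `U + V = 0`, which meets the cubic at infinity only.
* The line through infinity and `(u, v)` is `U + V = u + v`, whose third point is `(v, u)`.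
* The tangent at `(u, v)` is the line of the points `(u + t * v ^ 2, v - t * u ^ 2)`; it goes
  through infinity if `u = v`, and otherwise its residual point has `t = 3uv / (u³ - v³)`.
* The chord through distinct `(u₁, v₁)`, `(u₂, v₂)` goes through infinity if `u₁ + v₁ = u₂ + v₂`.
  Otherwise the point at parameter `t` of this chord, `(1 - t) (u₁, v₁) + t (u₂, v₂)`, is on the
  cubic for `t = 0`, `t = 1` and the value of `t` below. -/
def third : Point m → Point m → Point m
  | infinity, Q => neg Q
  | P, infinity => neg P
  | affine u₁ v₁ h₁, affine u₂ v₂ h₂ =>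
    if u₁ = u₂ ∧ v₁ = v₂ then
      if huv : u₁ = v₁ then infinity
      else
        affine (u₁ + 3 * u₁ * v₁ / (u₁ ^ 3 - v₁ ^ 3) * v₁ ^ 2)
          (v₁ - 3 * u₁ * v₁ / (u₁ ^ 3 - v₁ ^ 3) * u₁ ^ 2) (tangent_mem h₁ huv rfl)
    else
      if hs : u₁ + v₁ = u₂ + v₂ then infinity
      else
        affine
          (u₁ + ((m : ℚ) - (u₁ ^ 2 * u₂ + v₁ ^ 2 * v₂)) /
            ((u₁ * u₂ ^ 2 + v₁ * v₂ ^ 2) - (u₁ ^ 2 * u₂ + v₁ ^ 2 * v₂)) * (u₂ - u₁))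
          (v₁ + ((m : ℚ) - (u₁ ^ 2 * u₂ + v₁ ^ 2 * v₂)) /
            ((u₁ * u₂ ^ 2 + v₁ * v₂ ^ 2) - (u₁ ^ 2 * u₂ + v₁ ^ 2 * v₂)) * (v₂ - v₁))
          (chord_mem h₁ h₂ hs rfl)

/-- The identity of the group law is the point at infinity. -/
instance : Zero (Point m) := ⟨infinity⟩

/-- The chord and tangent addition: `P + Q` is the reflection of the third point of intersection. -/
instance : Add (Point m) := ⟨fun P Q => neg (third P Q)⟩

/-- The multiple `n R = R + ⋯ + R` (`n` summands). -/
def multiple (n : ℕ) (R : Point m) : Point m := nsmulRec n R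

/-- A point none of whose positive multiples is the identity. -/
def IsNontorsion (R : Point m) : Prop := ∀ n : ℕ, 0 < n → multiple n R ≠ 0

/-- The positive denominator of an affine point written in lowest terms, `(U / W, V / W)`, and `0`
at the point at infinity `(1 : -1 : 0)`. By `den_eq_den` the denominators of the two coordinates
agree. -/
def denominator : Point m → ℕ
  | infinity => 0
  | affine u _ _ => u.den

end Point

/-- The two coordinates of an affine rational point have the same denominator. -/
theorem den_eq_den {m : ℤ} {u v : ℚ} (h : u ^ 3 + v ^ 3 = (m : ℚ)) : u.den = v.den := by
  have key : ∀ a b : ℚ, a ^ 3 + b ^ 3 = (m : ℚ) → a.den ∣ b.den := by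
    intro a b hab
    have h1 : a ^ 3 = (m : ℚ) - b ^ 3 := by linear_combination hab
    have h2 : (a ^ 3).den ∣ ((m : ℚ)).den * (b ^ 3).den := h1 ▸ Rat.sub_den_dvd _ _
    rw [Rat.den_intCast, one_mul, Rat.den_pow, Rat.den_pow] at h2
    exact (Nat.pow_dvd_pow_iff (by decide)).1 h2
  exact Nat.dvd_antisymm (key u v h) (key v u (by rw [add_comm]; exact h))

/-- The sequence `W n` of the denominators of the multiples `n R = (U n / W n, V n / W n)`. -/
def W {m : ℤ} (R : Point m) (n : ℕ) : ℕ := (R.multiple n).denominator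

end TwistedFermat

namespace TwistedFermat

/-! For fixed `d`, the points whose denominator is divisible by `d` form a subgroup, infinity
included since its denominator is `0`. So the `n` with `d ∣ W R n` are closed under sums and
differences, and Euclid's algorithm gives `dvd_W_gcd`. Both divisibilities of the theorem follow.
Closure under addition is `dvd_denominator_add`, read off modulo `d` from an addition law that also
covers doubling. Rearranging multiples of `R` needs associativity, which is pulled back from a
Weierstrass model along an injective homomorphism. -/

theorem add_ne_zero_of_mem {m : ℤ} (hm : m ≠ 0) {u v : ℚ} (h : u ^ 3 + v ^ 3 = (m : ℚ)) :
    u + v ≠ 0 := by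
  intro h0
  have : (m : ℚ) = 0 := by linear_combination (u ^ 2 - u * v + v ^ 2) * h0 - h
  exact hm (by exact_mod_cast this)

/-! ### Transport of the group law from a Weierstrass model -/

/-- The Weierstrass cubic `Y ^ 2 = X ^ 3 - 432 m ^ 2`. -/
def weierstrass (m : ℤ) : WeierstrassCurve.Affine ℚ := ⟨0, 0, 0, 0, -432 * (m : ℚ) ^ 2⟩

theorem weierstrass_nonsingular {m : ℤ} (hm : m ≠ 0) {u v : ℚ} (h : u ^ 3 + v ^ 3 = (m : ℚ)) :
    (weierstrass m).Nonsingular (12 * m / (u + v)) (36 * m * (u - v) / (u + v)) := by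
  have hs := add_ne_zero_of_mem hm h
  have hm' : (m : ℚ) ≠ 0 := by exact_mod_cast hm
  rw [WeierstrassCurve.Affine.nonsingular_iff, WeierstrassCurve.Affine.equation_iff]
  refine ⟨?_, Or.inl ?_⟩
  · simp only [weierstrass]
    field_simp
    linear_combination 1728 * m * h
  · simp only [weierstrass]
    have : 3 * (12 * (m : ℚ) / (u + v)) ^ 2 ≠ 0 := by positivity
    intro h0
    exact this (by linear_combination -h0)

/-- The map `(u, v) ↦ (12 m / (u + v), 36 m (u - v) / (u + v))` to the Weierstrass model. -/
def toWeierstrass {m : ℤ} (hm : m ≠ 0) : Point m → (weierstrass m).Point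
  | .infinity => 0
  | .affine _ _ h => .some _ _ (weierstrass_nonsingular hm h)

theorem toWeierstrass_injective {m : ℤ} (hm : m ≠ 0) :
    Function.Injective (toWeierstrass (m := m) hm) := by
  have hm' : (m : ℚ) ≠ 0 := by exact_mod_cast hm
  rintro (_ | ⟨u, v, h⟩) (_ | ⟨u', v', h'⟩) he
  · rfl
  · exact absurd he.symm (WeierstrassCurve.Affine.Point.some_ne_zero _)
  · exact absurd he (WeierstrassCurve.Affine.Point.some_ne_zero _)
  · obtain ⟨hx, hy⟩ := WeierstrassCurve.Affine.Point.some.inj he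
    have hs := add_ne_zero_of_mem hm h
    have hs' := add_ne_zero_of_mem hm h'
    have hsum : u + v = u' + v' := by
      field_simp at hx
      exact hx.symm
    have hdiff : u - v = u' - v' := by
      rw [← hsum] at hy
      field_simp at hy
      exact hy
    obtain rfl : u = u' := by linarith
    obtain rfl : v = v' := by linarith
    rfl

theorem toWeierstrass_neg {m : ℤ} (hm : m ≠ 0) (P : Point m) :
    toWeierstrass hm P.neg = -toWeierstrass hm P := by
  rcases P with _ | ⟨u, v, h⟩
  · rfl
  · simp only [Point.neg, toWeierstrass]
    rw [WeierstrassCurve.Affine.Point.neg_some, WeierstrassCurve.Affine.Point.some.injEq]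
    simp only [WeierstrassCurve.Affine.negY, weierstrass]
    rw [add_comm v u]
    exact ⟨rfl, by ring⟩

theorem toWeierstrass_tangent {m : ℤ} (hm : m ≠ 0) {u v : ℚ} (h : u ^ 3 + v ^ 3 = (m : ℚ))
    (huv : u ≠ v) {t : ℚ} (ht : t = 3 * u * v / (u ^ 3 - v ^ 3)) :
    toWeierstrass hm (.affine u v h) + toWeierstrass hm (.affine u v h) =
      toWeierstrass hm (Point.neg (.affine _ _ (tangent_mem h huv ht))) := by
  have hm' : (m : ℚ) ≠ 0 := by exact_mod_cast hm
  have hs := add_ne_zero_of_mem hm h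
  have hd : u - v ≠ 0 := sub_ne_zero.2 huv
  have hs' := add_ne_zero_of_mem hm (tangent_mem h huv ht)
  have hq : u ^ 2 + u * v + v ^ 2 ≠ 0 := by
    have : 0 < (u + v) ^ 2 := by positivity
    nlinarith [sq_nonneg (u - v)]
  have ht' : t * ((u - v) * (u ^ 2 + u * v + v ^ 2)) = 3 * u * v := by
    rw [ht, show u ^ 3 - v ^ 3 = (u - v) * (u ^ 2 + u * v + v ^ 2) by ring,
      div_mul_cancel₀ _ (mul_ne_zero hd hq)]
  have hsum : (u + t * v ^ 2) + (v - t * u ^ 2) =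
      (u + v) * (u - v) ^ 2 / (u ^ 2 + u * v + v ^ 2) := by
    rw [eq_div_iff hq]
    linear_combination -(u + v) * ht'
  have hY : 36 * (m : ℚ) * (u - v) / (u + v) ≠
      (weierstrass m).negY (12 * m / (u + v)) (36 * m * (u - v) / (u + v)) := by
    simp only [WeierstrassCurve.Affine.negY, weierstrass]
    have : 36 * (m : ℚ) * (u - v) / (u + v) ≠ 0 :=
      div_ne_zero (mul_ne_zero (by positivity) hd) hs
    intro h0
    exact this (by linarith)
  have hslope : (weierstrass m).slope (12 * m / (u + v)) (12 * m / (u + v))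
      (36 * m * (u - v) / (u + v)) (36 * m * (u - v) / (u + v)) =
        6 * m / ((u + v) * (u - v)) := by
    rw [WeierstrassCurve.Affine.slope_of_Y_ne rfl hY,
      div_eq_div_iff (sub_ne_zero.2 hY) (mul_ne_zero hs hd)]
    simp only [WeierstrassCurve.Affine.negY, weierstrass]
    field_simp
    ring
  have hX : (6 * (m : ℚ) / ((u + v) * (u - v))) ^ 2 - 12 * m / (u + v) - 12 * m / (u + v) =
      12 * m / ((u + t * v ^ 2) + (v - t * u ^ 2)) := by
    rw [hsum]
    field_simp
    linear_combination -36 * h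
  simp only [toWeierstrass, Point.neg]
  rw [WeierstrassCurve.Affine.Point.add_self_of_Y_ne hY,
    WeierstrassCurve.Affine.Point.some.injEq, hslope]
  simp only [WeierstrassCurve.Affine.addY, WeierstrassCurve.Affine.negAddY,
    WeierstrassCurve.Affine.addX, WeierstrassCurve.Affine.negY, weierstrass]
  rw [show ∀ a b x : ℚ, a + 0 * b - 0 - x - x = a - x - x by intros; ring, hX,
    add_comm (v - t * u ^ 2)]
  refine ⟨rfl, ?_⟩
  generalize hs₃ : u + t * v ^ 2 + (v - t * u ^ 2) = s₃ at hs' ⊢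
  field_simp
  linear_combination 72 * m * (u + v) * (u - v) * t * h -
    36 * m * (2 * m - (u + v) * (u - v) ^ 2) * hs₃

theorem toWeierstrass_chord {m : ℤ} (hm : m ≠ 0) {u₁ v₁ u₂ v₂ : ℚ}
    (h₁ : u₁ ^ 3 + v₁ ^ 3 = (m : ℚ)) (h₂ : u₂ ^ 3 + v₂ ^ 3 = (m : ℚ))
    (hs : u₁ + v₁ ≠ u₂ + v₂) {t : ℚ}
    (ht : t = ((m : ℚ) - (u₁ ^ 2 * u₂ + v₁ ^ 2 * v₂)) /
      ((u₁ * u₂ ^ 2 + v₁ * v₂ ^ 2) - (u₁ ^ 2 * u₂ + v₁ ^ 2 * v₂))) :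
    toWeierstrass hm (.affine u₁ v₁ h₁) + toWeierstrass hm (.affine u₂ v₂ h₂) =
      toWeierstrass hm (Point.neg (.affine _ _ (chord_mem h₁ h₂ hs ht))) := by
  have hm' : (m : ℚ) ≠ 0 := by exact_mod_cast hm
  have hs₁ := add_ne_zero_of_mem hm h₁
  have hs₂ := add_ne_zero_of_mem hm h₂
  have hs₃ := add_ne_zero_of_mem hm (chord_mem h₁ h₂ hs ht)
  have hD := chord_ne h₁ h₂ hs
  have ht' := (eq_div_iff hD).1 ht
  have hd : u₂ + v₂ - (u₁ + v₁) ≠ 0 := sub_ne_zero.2 hs.symm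
  have hXne : 12 * (m : ℚ) / (u₁ + v₁) ≠ 12 * m / (u₂ + v₂) := by
    intro h0
    field_simp at h0
    exact hs h0.symm
  have hslope : (weierstrass m).slope (12 * m / (u₁ + v₁)) (12 * m / (u₂ + v₂))
      (36 * m * (u₁ - v₁) / (u₁ + v₁)) (36 * m * (u₂ - v₂) / (u₂ + v₂)) =
        3 * ((u₁ - v₁) * (u₂ + v₂) - (u₂ - v₂) * (u₁ + v₁)) / (u₂ + v₂ - (u₁ + v₁)) := by
    rw [WeierstrassCurve.Affine.slope_of_X_ne hXne, div_eq_div_iff (sub_ne_zero.2 hXne) hd]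
    field_simp
    ring
  have hX : (3 * ((u₁ - v₁) * (u₂ + v₂) - (u₂ - v₂) * (u₁ + v₁)) /
      (u₂ + v₂ - (u₁ + v₁))) ^ 2 - 12 * m / (u₁ + v₁) - 12 * m / (u₂ + v₂) =
        12 * m / ((u₁ + t * (u₂ - u₁)) + (v₁ + t * (v₂ - v₁))) := by
    -- Closed form, free of `t`, for the coordinate sum of the third point. By `hA` and `hB` the
    -- denominator of `t` contains the factor `u₂ + v₂ - (u₁ + v₁)`, which is then cancelled.
    have hσ : (u₁ + t * (u₂ - u₁) + (v₁ + t * (v₂ - v₁))) *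
        (2 * m * (u₁ + v₁ + (u₂ + v₂)) - (u₁ + v₁) * (u₂ + v₂) *
          ((u₁ + v₁) * (u₂ + v₂) + 3 * (u₁ - v₁) * (u₂ - v₂))) =
        2 * m * (u₂ + v₂ - (u₁ + v₁)) ^ 2 := by
      have hA : 6 * (u₁ + v₁) * (u₂ + v₂) * (u₁ ^ 2 * u₂ + v₁ ^ 2 * v₂) =
          (u₁ + v₁) * ((u₁ + v₁) * (u₂ + v₂) *
            ((u₁ + v₁) * (u₂ + v₂) + 3 * (u₁ - v₁) * (u₂ - v₂))) +
          2 * m * (u₂ + v₂) ^ 2 := by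
        linear_combination 2 * (u₂ + v₂) ^ 2 * h₁
      have hB : 6 * (u₁ + v₁) * (u₂ + v₂) * (u₁ * u₂ ^ 2 + v₁ * v₂ ^ 2) =
          (u₂ + v₂) * ((u₁ + v₁) * (u₂ + v₂) *
            ((u₁ + v₁) * (u₂ + v₂) + 3 * (u₁ - v₁) * (u₂ - v₂))) +
          2 * m * (u₁ + v₁) ^ 2 := by
        linear_combination 2 * (u₁ + v₁) ^ 2 * h₂
      refine mul_left_cancel₀ hd ?_
      linear_combination
        (u₁ + t * (u₂ - u₁) + (v₁ + t * (v₂ - v₁))) * (hB - hA) -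
        6 * (u₁ + v₁) * (u₂ + v₂) * (u₂ + v₂ - (u₁ + v₁)) * ht' -
        ((u₁ + v₁) * hB - (u₂ + v₂) * hA)
    rw [show (3 * ((u₁ - v₁) * (u₂ + v₂) - (u₂ - v₂) * (u₁ + v₁)) /
      (u₂ + v₂ - (u₁ + v₁))) ^ 2 - 12 * m / (u₁ + v₁) - 12 * m / (u₂ + v₂) =
        6 * (2 * m * (u₁ + v₁ + (u₂ + v₂)) - (u₁ + v₁) * (u₂ + v₂) *
          ((u₁ + v₁) * (u₂ + v₂) + 3 * (u₁ - v₁) * (u₂ - v₂))) /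
          (u₂ + v₂ - (u₁ + v₁)) ^ 2 by
      field_simp
      linear_combination 12 * (u₂ + v₂) ^ 3 * h₁ + 12 * (u₁ + v₁) ^ 3 * h₂,
      div_eq_div_iff (pow_ne_zero 2 hd) hs₃]
    linear_combination 6 * hσ
  simp only [toWeierstrass, Point.neg]
  rw [WeierstrassCurve.Affine.Point.add_of_X_ne hXne,
    WeierstrassCurve.Affine.Point.some.injEq, hslope]
  simp only [WeierstrassCurve.Affine.addY, WeierstrassCurve.Affine.negAddY,
    WeierstrassCurve.Affine.addX, WeierstrassCurve.Affine.negY, weierstrass]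
  rw [show ∀ a b x y : ℚ, a + 0 * b - 0 - x - y = a - x - y by intros; ring, hX,
    add_comm (v₁ + t * (v₂ - v₁))]
  refine ⟨rfl, ?_⟩
  field_simp
  ring

/-- The map is the projective linear change `(U : V : W) ↦ (12 m W : 36 m (U - V) : U + V)`, so it
preserves lines and intersection multiplicities, and it matches the two identities. -/
theorem toWeierstrass_add {m : ℤ} (hm : m ≠ 0) (P Q : Point m) :
    toWeierstrass hm (P + Q) = toWeierstrass hm P + toWeierstrass hm Q := by
  change toWeierstrass hm (Point.neg (Point.third P Q)) = _
  rcases P with _ | ⟨u₁, v₁, h₁⟩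
  · change toWeierstrass hm (Point.neg (Point.neg Q)) = 0 + _
    rw [toWeierstrass_neg, toWeierstrass_neg, neg_neg, zero_add]
  rcases Q with _ | ⟨u₂, v₂, h₂⟩
  · change toWeierstrass hm (Point.neg (Point.neg (.affine u₁ v₁ h₁))) = _ + 0
    rw [toWeierstrass_neg, toWeierstrass_neg, neg_neg, add_zero]
  rw [Point.third]
  split_ifs with he huv hs
  · obtain ⟨rfl, rfl⟩ := he
    subst huv
    -- Points with `u = v` go to `Y = 0`, the 2-torsion.
    refine (WeierstrassCurve.Affine.Point.add_self_of_Y_eq ?_).symm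
    simp [WeierstrassCurve.Affine.negY, weierstrass]
  · obtain ⟨rfl, rfl⟩ := he
    exact (toWeierstrass_tangent hm h₁ huv rfl).symm
  · refine (WeierstrassCurve.Affine.Point.add_of_Y_eq (by rw [hs]) ?_).symm
    simp only [WeierstrassCurve.Affine.negY, weierstrass]
    have hs₂ := add_ne_zero_of_mem hm h₂
    -- On a line `U + V = s` the cubic becomes quadratic in `U`, with roots exchanged by the
    -- reflection; two distinct points there are mutually inverse.
    have hprod : (u₁ - u₂) * ((u₂ + v₂) * (u₁ - v₂)) = 0 := by
      have h₁' := h₁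
      rw [show v₁ = u₂ + v₂ - u₁ by linarith] at h₁'
      linear_combination (h₁' - h₂) / 3
    have hne : u₁ - u₂ ≠ 0 := fun h0 => he ⟨by linarith, by linarith⟩
    have hv : u₁ = v₂ := by
      have := (mul_eq_zero.1 ((mul_eq_zero.1 hprod).resolve_left hne)).resolve_left hs₂
      linarith
    have hu : v₁ = u₂ := by linarith
    subst hv hu
    rw [hs]
    ring
  · exact (toWeierstrass_chord hm h₁ h₂ hs rfl).symm

/-! ### Denominators under addition -/

/-- The sum of `(u₁, v₁)` and `(u₂, v₂)` is given by the rotated addition law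
`(m W₁² W₂ V₂ + U₂² U₁ V₁ : -m W₂² W₁ U₁ - V₁² U₂ V₂ : V₂² W₁ V₁ - U₁² W₂ U₂)`. -/
theorem add_rotated {m : ℤ} {u₁ v₁ u₂ v₂ u v : ℚ} (h₁ : u₁ ^ 3 + v₁ ^ 3 = (m : ℚ))
    (h₂ : u₂ ^ 3 + v₂ ^ 3 = (m : ℚ)) (h : u ^ 3 + v ^ 3 = (m : ℚ))
    (hsum : Point.affine u₁ v₁ h₁ + Point.affine u₂ v₂ h₂ = Point.affine u v h) :
    u * (v₂ ^ 2 * v₁ - u₁ ^ 2 * u₂) = m * v₂ + u₂ ^ 2 * u₁ * v₁ := by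
  change Point.neg (Point.third _ _) = _ at hsum
  rw [Point.third] at hsum
  split_ifs at hsum with he huv hs
  · simp [Point.neg] at hsum
  · obtain ⟨rfl, rfl⟩ := he
    simp only [Point.neg, Point.affine.injEq] at hsum
    have hne : u₁ ^ 3 - v₁ ^ 3 ≠ 0 := fun h0 =>
      huv ((Odd.strictMono_pow (by decide : Odd 3)).injective (sub_eq_zero.1 h0))
    rw [← hsum.1]
    field_simp
    linear_combination v₁ * (u₁ ^ 3 - v₁ ^ 3) * h₁
  · simp [Point.neg] at hsum
  · simp only [Point.neg, Point.affine.injEq] at hsum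
    have hne := chord_ne h₁ h₂ hs
    obtain ⟨t, ht⟩ : ∃ t : ℚ, t = ((m : ℚ) - (u₁ ^ 2 * u₂ + v₁ ^ 2 * v₂)) /
      ((u₁ * u₂ ^ 2 + v₁ * v₂ ^ 2) - (u₁ ^ 2 * u₂ + v₁ ^ 2 * v₂)) := ⟨_, rfl⟩
    rw [← ht] at hsum
    have ht' := (eq_div_iff hne).1 ht
    rw [← hsum.1]
    refine mul_right_cancel₀ hne ?_
    linear_combination (v₂ - v₁) * (v₂ ^ 2 * v₁ - u₁ ^ 2 * u₂) * ht' -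
      ((v₂ - v₁) * (v₂ ^ 2 * v₁ - u₁ ^ 2 * u₂) -
        ((u₁ * u₂ ^ 2 + v₁ * v₂ ^ 2) - (u₁ ^ 2 * u₂ + v₁ ^ 2 * v₂)) * v₂) * h₁ +
      u₁ ^ 2 * v₁ * u₂ * (h₁ - h₂)

/-- In the rotated law each term of the third coordinate contains `W₁` or `W₂`, so `d` divides it,
while the first is `U₂² U₁ V₁` modulo `d`, a unit because the fractions are reduced. -/
theorem dvd_denominator_add {m : ℤ} {d : ℕ} {P Q : Point m} (hP : d ∣ P.denominator)
    (hQ : d ∣ Q.denominator) : d ∣ (P + Q).denominator := by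
  have hneg : ∀ P : Point m, P.neg.neg = P := by rintro (_ | _) <;> rfl
  rcases P with _ | ⟨u₁, v₁, h₁⟩
  · change d ∣ (Point.neg (Point.neg Q)).denominator
    rwa [hneg]
  rcases Q with _ | ⟨u₂, v₂, h₂⟩
  · change d ∣ (Point.neg (Point.neg (Point.affine u₁ v₁ h₁))).denominator
    rwa [hneg]
  rcases hsum : Point.affine u₁ v₁ h₁ + Point.affine u₂ v₂ h₂ with _ | ⟨u, v, h⟩
  · exact dvd_zero d
  have key := add_rotated h₁ h₂ h hsum
  have hd₁ := den_eq_den h₁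
  have hd₂ := den_eq_den h₂
  change d ∣ u₁.den at hP
  change d ∣ u₂.den at hQ
  change d ∣ u.den
  -- `key` with denominators cleared, using that both coordinates of a point share one.
  have hint : u.num * (v₂.num ^ 2 * v₁.num * u₁.den - u₁.num ^ 2 * u₂.num * u₂.den) =
      (m * v₂.num * u₂.den * u₁.den ^ 2 + u₂.num ^ 2 * u₁.num * v₁.num) * u.den := by
    have e : ∀ q : ℚ, (q.num : ℚ) = q * q.den := fun q => (Rat.mul_den_eq_num q).symm
    have : ((u.num * (v₂.num ^ 2 * v₁.num * u₁.den - u₁.num ^ 2 * u₂.num * u₂.den) : ℤ) : ℚ) =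
      ((m * v₂.num * u₂.den * u₁.den ^ 2 + u₂.num ^ 2 * u₁.num * v₁.num) * u.den : ℤ) := by
      push_cast
      rw [e u, e u₁, e u₂, e v₁, e v₂, ← hd₁, ← hd₂]
      linear_combination (u.den : ℚ) * u₁.den ^ 2 * u₂.den ^ 2 * key
    exact_mod_cast this
  have cop : ∀ q : ℚ, d ∣ q.den → IsCoprime (d : ℤ) q.num := fun q hq =>
    (Int.isCoprime_iff_gcd_eq_one.2
      (by simpa [Int.gcd] using q.reduced.symm) : IsCoprime (q.den : ℤ) q.num).of_isCoprime_of_dvd_left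
      (Int.natCast_dvd_natCast.2 hq)
  have hP' : (d : ℤ) ∣ u₁.den := Int.natCast_dvd_natCast.2 hP
  have hQ' : (d : ℤ) ∣ u₂.den := Int.natCast_dvd_natCast.2 hQ
  have hcop : IsCoprime (d : ℤ)
      (m * v₂.num * u₂.den * u₁.den ^ 2 + u₂.num ^ 2 * u₁.num * v₁.num) := by
    obtain ⟨c, hc⟩ := hQ'
    rw [hc, show m * v₂.num * (d * c) * (u₁.den : ℤ) ^ 2 + u₂.num ^ 2 * u₁.num * v₁.num =
      u₂.num ^ 2 * u₁.num * v₁.num + d * (m * v₂.num * c * (u₁.den : ℤ) ^ 2) by ring]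
    exact (((cop u₂ hQ).pow_right.mul_right (cop u₁ hP)).mul_right
      (cop v₁ (hd₁ ▸ hP))).add_mul_left_right _
  refine Int.natCast_dvd_natCast.1 (hcop.dvd_of_dvd_mul_left ?_)
  rw [← hint]
  exact dvd_mul_of_dvd_right (dvd_sub (dvd_mul_of_dvd_right hP' _) (dvd_mul_of_dvd_right hQ' _)) _

theorem denominator_neg {m : ℤ} (P : Point m) : P.neg.denominator = P.denominator := by
  rcases P with _ | ⟨u, v, h⟩
  · rfl
  · exact (den_eq_den h).symm

/-! ### Multiples of a point and Euclid's algorithm -/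

theorem toWeierstrass_multiple {m : ℤ} (hm : m ≠ 0) (R : Point m) (n : ℕ) :
    toWeierstrass hm (R.multiple n) = n • toWeierstrass hm R := by
  induction n with
  | zero => exact (zero_nsmul _).symm
  | succ n ih => rw [succ_nsmul, ← ih, ← toWeierstrass_add]; rfl

theorem multiple_add {m : ℤ} (hm : m ≠ 0) (R : Point m) (a b : ℕ) :
    R.multiple (a + b) = R.multiple a + R.multiple b := by
  apply toWeierstrass_injective hm
  simp only [toWeierstrass_add, toWeierstrass_multiple, add_nsmul]

theorem multiple_eq_add_neg {m : ℤ} (hm : m ≠ 0) (R : Point m) (a b : ℕ) :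
    R.multiple b = R.multiple (a + b) + (R.multiple a).neg := by
  apply toWeierstrass_injective hm
  simp only [toWeierstrass_add, toWeierstrass_neg, toWeierstrass_multiple, add_nsmul]
  abel

theorem dvd_W_mul {m : ℤ} (hm : m ≠ 0) (R : Point m) {d n : ℕ} (h : d ∣ W R n) (k : ℕ) :
    d ∣ W R (n * k) := by
  induction k with
  | zero => exact dvd_zero d
  | succ k ih =>
    rw [W, Nat.mul_succ, multiple_add hm]
    exact dvd_denominator_add ih h

theorem dvd_W_gcd {m : ℤ} (hm : m ≠ 0) (R : Point m) {d : ℕ} (a b : ℕ) :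
    d ∣ W R a → d ∣ W R b → d ∣ W R (a.gcd b) := by
  induction a, b using Nat.gcd.induction with
  | H0 n => intro _ h; rwa [Nat.gcd_zero_left]
  | H1 a b _ ih =>
    intro ha hb
    rw [Nat.gcd_rec]
    refine ih ?_ ha
    -- Euclid's step: `(b % a) R = b R - (a * (b / a)) R`.
    rw [W, multiple_eq_add_neg hm R (a * (b / a)), Nat.div_add_mod]
    exact dvd_denominator_add hb ((denominator_neg _).symm ▸ dvd_W_mul hm R ha _)

end TwistedFermat

theorem proposition3p3 (m : ℤ) (hm : m ≠ 0) (R : TwistedFermat.Point m)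
    (hR : R.IsNontorsion) :
    (∀ r n : ℕ, 0 < r → 0 < n →
      Nat.gcd (TwistedFermat.W R r) (TwistedFermat.W R n) = TwistedFermat.W R (Nat.gcd r n)) ∧
    (∀ n k : ℕ, 0 < n → 0 < k → TwistedFermat.W R n ∣ TwistedFermat.W R (n * k)) := by
  have hmul : ∀ {a b : ℕ}, a ∣ b → TwistedFermat.W R a ∣ TwistedFermat.W R b := by
    rintro a _ ⟨k, rfl⟩
    exact TwistedFermat.dvd_W_mul hm R dvd_rfl k
  refine ⟨fun r n _ _ => Nat.dvd_antisymm ?_ ?_, fun n k _ _ => hmul (dvd_mul_right n k)⟩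
  · exact TwistedFermat.dvd_W_gcd hm R r n (Nat.gcd_dvd_left _ _) (Nat.gcd_dvd_right _ _)
  · exact Nat.dvd_gcd (hmul (Nat.gcd_dvd_left r n)) (hmul (Nat.gcd_dvd_right r n))
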